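/- Let $k$ be a field of characteristic $p\ge 0$ with algebraic closure $\overline k$, let $n$ be a natural number, and let $$\sigma=\sum_{i_1,\ldots,i_n\in\mathbb N}\alpha_{i_1,\ldots,i_n}x_1^{i_1}\cdots x_n^{i_n}\in\overline k[[x_1,\ldots,x_n]].$$ Let $L=k(\{\alpha_{i_1,\ldots,i_n}\mid i_1,\ldots,i_n\in\mathbb N\})\subseteq\overline k$ be the extension field of $k$ generated by the coefficients of $\sigma$. Write $k((x_1,\ldots,x_n))$ for the quotient field of $k[[x_1,\ldots,x_n]]$. For $r\in\mathbb N=\{0,1,2,\ldots\}$ put $L^{p^r}=\{f^{p^r}\mid f\in L\}$ if $p>0$, and $L^{p^r}=L$ if $p=0$, and let $kL^{p^r}$ be the compositum of $k$ and $L^{p^r}$ in $\overline k$. Then $\sigma$ is algebraic over $k((x_1,\ldots,x_n))$ if and only if there exists $r\in\mathbb N$ such that $[kL^{p^r}:k]<\infty$. -/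

import Mathlib

noncomputable section

/-- The ring of formal power series over a field is an integral domain. -/
instance MvPowerSeries.isDomain_of_field {n : ℕ} {K : Type*} [Field K] :
    IsDomain (MvPowerSeries (Fin n) K) :=
  NoZeroDivisors.to_isDomain _

/-- The field `k((x₁, …, xₙ))`: the quotient field of the ring `k[[x₁, …, xₙ]]`. -/
abbrev LaurentField (n : ℕ) (k : Type*) [Field k] : Type _ :=
  FractionRing (MvPowerSeries (Fin n) k)

/-- For a field extension `K / k`, the inclusion `k((x₁, …, xₙ)) → K((x₁, …, xₙ))`
induced by the coefficientwise inclusion `k[[x₁, …, xₙ]] → K[[x₁, …, xₙ]]`. -/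
def LaurentField.inclusion (n : ℕ) (k K : Type*) [Field k] [Field K] [Algebra k K] :
    LaurentField n k →+* LaurentField n K :=
  IsFractionRing.map (j := MvPowerSeries.map (σ := Fin n) (algebraMap k K))
    (fun _ _ h => MvPowerSeries.ext fun I =>
      (algebraMap k K).injective (by simpa using congrArg (MvPowerSeries.coeff I) h))

/-- On power series, the inclusion acts coefficientwise. -/
theorem LaurentField.inclusion_algebraMap (n : ℕ) (k K : Type*) [Field k] [Field K]
    [Algebra k K] (f : MvPowerSeries (Fin n) k) :
    LaurentField.inclusion n k K (algebraMap _ (LaurentField n k) f) =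
      algebraMap _ (LaurentField n K) (MvPowerSeries.map (algebraMap k K) f) := by
  simp [LaurentField.inclusion, IsFractionRing.map]

/-- `s ∈ K[[x₁, …, xₙ]]` is algebraic over `k((x₁, …, xₙ))`, both being viewed inside
`K((x₁, …, xₙ))`. -/
def IsAlgebraicSeries {n : ℕ} (k : Type*) {K : Type*} [Field k] [Field K] [Algebra k K]
    (s : MvPowerSeries (Fin n) K) : Prop :=
  letI : Algebra (LaurentField n k) (LaurentField n K) :=
    (LaurentField.inclusion n k K).toAlgebra
  IsAlgebraic (LaurentField n k) (algebraMap _ (LaurentField n K) s)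

/-- The extension field `L` of `k` generated inside `K` by the coefficients of `s`. -/
def coeffField {n : ℕ} (k : Type*) {K : Type*} [Field k] [Field K] [Algebra k K]
    (s : MvPowerSeries (Fin n) K) : IntermediateField k K :=
  IntermediateField.adjoin k (Set.range fun I : Fin n →₀ ℕ => MvPowerSeries.coeff I s)

/-- In characteristic `p > 0`, the set `L ^ (p ^ r)` of `p ^ r`-th powers of elements of `L`;
in characteristic `p = 0` the convention is `L ^ (p ^ r) = L` for all `r`. -/
def powerField {k K : Type*} [Field k] [Field K] [Algebra k K] (p : ℕ)
    (L : IntermediateField k K) (r : ℕ) : Set K :=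
  if p = 0 then (L : Set K) else {y | ∃ x ∈ L, y = x ^ (p ^ r)}

/-- The compositum in `K` of `k` and `L ^ (p ^ r)`: the smallest subfield containing both. -/
def powerCompositum {k K : Type*} [Field k] [Field K] [Algebra k K] (p : ℕ)
    (L : IntermediateField k K) (r : ℕ) : IntermediateField k K :=
  IntermediateField.adjoin k (powerField p L r)

end

/-! Let `q` be the exponential characteristic. Both sides are insensitive to replacing `σ` by a
power `σ ^ q ^ r`: Frobenius turns `k L^{q^r}` into the coefficient field of that power
(`coeffField_pow_expChar_eq_adjoin`). If that field is finite over `k`, expand in a basis.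
Conversely, some power `t` of an algebraic `σ` is a simple root of a polynomial `f` over `k[[x]]`.
As in Hensel's lemma, the coefficients of `t` up to the order of `f'(t)` determine the field
containing all the others (`coeff_mem_range_of_root`), and these are finitely many algebraic
elements. -/

/-- Apply an additive map to every coefficient of a multivariate power series. -/
def MvPowerSeries.mapAddMonoidHom {ι A B : Type*} [Semiring A] [Semiring B] (φ : A →+ B) :
    MvPowerSeries ι A →+ MvPowerSeries ι B where
  toFun s := fun I => φ (MvPowerSeries.coeff I s)
  map_zero' := funext fun _ => map_zero φ
  map_add' _ _ := funext fun _ => map_add φ _ _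

namespace MvPowerSeries

theorem coeff_mapAddMonoidHom {ι A B : Type*} [Semiring A] [Semiring B] (φ : A →+ B)
    (s : MvPowerSeries ι A) (I : ι →₀ ℕ) : coeff I (mapAddMonoidHom φ s) = φ (coeff I s) :=
  rfl

/-- The coefficientwise extension of a `k`-linear map is linear over power series over `k`. -/
theorem mapAddMonoidHom_map_mul {ι k A B : Type*} [CommSemiring k] [Semiring A] [Algebra k A]
    [Semiring B] [Algebra k B] (φ : A →ₗ[k] B) (g : MvPowerSeries ι k) (s : MvPowerSeries ι A) :
    mapAddMonoidHom φ.toAddMonoidHom (map (algebraMap k A) g * s) =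
      map (algebraMap k B) g * mapAddMonoidHom φ.toAddMonoidHom s := by
  classical
  ext I
  simp only [coeff_mapAddMonoidHom, coeff_mul, map_sum, coeff_map]
  refine Finset.sum_congr rfl fun x _ => ?_
  rw [← Algebra.smul_def, ← Algebra.smul_def]
  exact φ.map_smul _ _

theorem order_le_order_mapAddMonoidHom {ι A B : Type*} [Semiring A] [Semiring B] (φ : A →+ B)
    (s : MvPowerSeries ι A) : s.order ≤ (mapAddMonoidHom φ s).order :=
  le_order fun d hd => by rw [coeff_mapAddMonoidHom, coeff_of_lt_order hd, map_zero]

/-- Let `s` be a root of a polynomial `f` over `k[[x]]`. If the coefficients of `s` up to the order of `f'(s)` lie in `k`, then all do. -/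
theorem coeff_mem_range_of_root {ι k K : Type*} [Field k] [Field K] [Algebra k K]
    (f : Polynomial (MvPowerSeries ι k)) (s : MvPowerSeries ι K)
    (hs : f.eval₂ (map (algebraMap k K)) s = 0)
    (h : ∀ I : ι →₀ ℕ, (I.degree : ℕ∞) ≤ (f.derivative.eval₂ (map (algebraMap k K)) s).order →
      coeff I s ∈ Set.range (algebraMap k K)) (I : ι →₀ ℕ) :
    coeff I s ∈ Set.range (algebraMap k K) := by
  -- Split `K` as `k` plus a `k`-linear complement; `δ = Ψ s` is the part of `s` off `k`, to be
  -- shown zero.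
  obtain ⟨φ, hφ⟩ := (Algebra.linearMap k K).exists_leftInverse_of_injective
    (LinearMap.ker_eq_bot.2 (algebraMap k K).injective)
  replace hφ (a : k) : φ (algebraMap k K a) = a := LinearMap.congr_fun hφ a
  let ψ : K →ₗ[k] K := LinearMap.id - (Algebra.linearMap k K).comp φ
  have hψ_apply (a : K) : ψ a = a - algebraMap k K (φ a) := rfl
  have hψ (a : k) : ψ (algebraMap k K a) = 0 := by rw [hψ_apply, hφ, sub_self]
  let Ψ := mapAddMonoidHom (ι := ι) ψ.toAddMonoidHom
  let t : MvPowerSeries ι k := mapAddMonoidHom φ.toAddMonoidHom s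
  have hΨ_map (g : MvPowerSeries ι k) : Ψ (map (algebraMap k K) g) = 0 := by
    ext J
    exact (congrArg ψ (coeff_map _ _ _)).trans (hψ _)
  have hdecomp : s = map (algebraMap k K) t + Ψ s := by
    ext J
    rw [map_add, coeff_map]
    change _ = algebraMap k K (φ _) + ψ (coeff J s)
    rw [hψ_apply]; ring
  set δ := Ψ s with hδ
  have hΨδ : Ψ δ = δ := by
    conv_rhs => rw [hδ, hdecomp, map_add, hΨ_map, zero_add]
  suffices hδ0 : δ = 0 by
    rw [hdecomp, hδ0, add_zero, coeff_map]
    exact ⟨_, rfl⟩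
  by_contra hδ0
  let F := f.map (map (σ := ι) (algebraMap k K))
  let T := map (algebraMap k K) t
  have hF : F.eval s = 0 := by rwa [Polynomial.eval_map]
  have horder : (F.derivative.eval s).order < δ.order := by
    by_contra! hle
    obtain ⟨J, hJ, hJd⟩ := exists_coeff_ne_zero_and_order (ne_zero_iff_order_finite.1 hδ0)
    rw [← hJd, Polynomial.derivative_map, Polynomial.eval_map] at hle
    obtain ⟨a, ha⟩ := h J hle
    refine hJ ?_
    change ψ (coeff J s) = 0
    rw [← ha, hψ]
  -- `F'(T)` and `F'(s)` differ by a multiple of `δ`, whose order is too large to affect the leading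
  -- terms.
  have horderT : (F.derivative.eval T).order = (F.derivative.eval s).order := by
    obtain ⟨c, hc⟩ := Polynomial.evalSubFactor F.derivative T s
    have hlt : (F.derivative.eval s).order < (c * (T - s)).order := by
      refine horder.trans_le ?_
      rw [order_mul, show T - s = -δ by rw [hdecomp]; simp [T], order_neg]
      exact le_add_self
    rw [sub_eq_iff_eq_add.1 hc, order_add_of_order_ne hlt.ne', min_eq_right hlt.le]
  obtain ⟨c, hc⟩ := Polynomial.binomExpansion F T δ
  rw [← hdecomp, hF] at hc
  have hFT : F.eval T = map (algebraMap k K) (f.eval t) := Polynomial.eval_map_apply _ _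
  have hFT' : F.derivative.eval T = map (algebraMap k K) (f.derivative.eval t) := by
    rw [Polynomial.derivative_map]; exact Polynomial.eval_map_apply _ _
  -- Apply `Ψ` to `0 = F(T) + F'(T) δ + c δ²`: it kills `F(T)`, defined over `k`, and commutes with
  -- `F'(T)`. The orders then force `2 ord δ ≤ ord F'(s) + ord δ`.
  have hmul : F.derivative.eval T * δ = -Ψ (c * δ ^ 2) := by
    have := congrArg Ψ hc
    rw [map_zero, map_add, map_add, hFT, hΨ_map, zero_add, hFT',
      show Ψ (_ * δ) = _ * Ψ δ from mapAddMonoidHom_map_mul ψ _ _, hΨδ] at this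
    rw [hFT']
    exact eq_neg_of_add_eq_zero_left this.symm
  have h2 : δ.order + δ.order ≤ (F.derivative.eval s).order + δ.order := by
    calc δ.order + δ.order ≤ (c * δ ^ 2).order := by
          rw [order_mul, sq, order_mul]; exact le_add_self
      _ ≤ (Ψ (c * δ ^ 2)).order := order_le_order_mapAddMonoidHom _ _
      _ = (F.derivative.eval s).order + δ.order := by
          rw [← order_neg, ← hmul, order_mul, horderT]
  exact (WithTop.add_lt_add_right (mt order_eq_top_iff.1 hδ0) horder).not_ge h2

/-- In exponential characteristic `q`, the nonzero coefficients of `s ^ q ^ r` are the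
`q ^ r`-th powers of those of `s`. -/
theorem coeff_pow_expChar_smul {ι K : Type*} [Field K] (q : ℕ) [ExpChar K q] (r : ℕ)
    (s : MvPowerSeries ι K) (I : ι →₀ ℕ) :
    coeff (q ^ r • I) (s ^ q ^ r) = coeff I s ^ q ^ r := by
  rw [← map_iterateFrobenius_expand q (expChar_ne_zero K q), coeff_map, coeff_expand_smul,
    iterateFrobenius_def]

/-- By Frobenius, `s ^ q ^ r` only involves exponents divisible by `q ^ r`. -/
theorem coeff_pow_expChar_mem {ι K : Type*} [Field K] (q : ℕ) [ExpChar K q] (r : ℕ)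
    (s : MvPowerSeries ι K) (I : ι →₀ ℕ) :
    coeff I (s ^ q ^ r) = 0 ∨ ∃ J, coeff I (s ^ q ^ r) = coeff J s ^ q ^ r := by
  by_cases h : ∀ i, q ^ r ∣ I i
  · obtain ⟨J, rfl⟩ : ∃ J, q ^ r • J = I := ⟨I.mapRange (fun a ↦ a / q ^ r) (by simp), by
      ext i; simp [Nat.mul_div_cancel' (h i)]⟩
    exact .inr ⟨J, coeff_pow_expChar_smul q r s J⟩
  · push Not at h
    obtain ⟨i, hi⟩ := h
    left
    rw [← map_iterateFrobenius_expand q (expChar_ne_zero K q), coeff_map,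
      coeff_expand_of_not_dvd _ _ _ hi, map_zero]

/-- A power series whose coefficients lie in a finite extension of `k` is a linear combination
of power series over `k`. -/
theorem exists_eq_sum_of_coeff_mem {ι k K : Type*} [Field k] [Field K] [Algebra k K]
    (M : IntermediateField k K) [FiniteDimensional k M] (s : MvPowerSeries ι K)
    (hs : ∀ I, coeff I s ∈ M) :
    ∃ (m : ℕ) (e : Fin m → K) (g : Fin m → MvPowerSeries ι k), (∀ j, e j ∈ M) ∧
      s = ∑ j, C (e j) * map (algebraMap k K) (g j) := by
  let b := Module.finBasis k M
  let g (j : Fin (Module.finrank k M)) : MvPowerSeries ι k :=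
    fun I => b.repr ⟨coeff I s, hs I⟩ j
  refine ⟨_, fun j => b j, g, fun j => (b j).2, ?_⟩
  ext I
  have := congrArg (Subtype.val) (b.sum_repr ⟨coeff I s, hs I⟩)
  rw [AddSubmonoidClass.coe_finsetSum] at this
  rw [map_sum]
  refine this.symm.trans ?_
  refine Finset.sum_congr rfl fun j _ => ?_
  rw [coeff_C_mul, coeff_map, mul_comm]
  exact Algebra.smul_def _ _

end MvPowerSeries

open Polynomial in
/-- An algebraic element of an extension of fraction fields has a `q ^ r`-th power that is a
simple root of a polynomial with coefficients in the base ring. -/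
theorem IsAlgebraic.exists_simple_root_pow {R S E F : Type*} [CommRing R] [IsDomain R]
    [CommRing S] [Field E] [Algebra R E] [IsFractionRing R E] [Field F] [Algebra S F]
    [FaithfulSMul S F] [Algebra E F] (q : ℕ) [ExpChar E q] (j : R →+* S)
    (hj : (algebraMap E F).comp (algebraMap R E) = (algebraMap S F).comp j) {s : S}
    (hs : IsAlgebraic E (algebraMap S F s)) :
    ∃ (r : ℕ) (f : R[X]), f.eval₂ j (s ^ q ^ r) = 0 ∧ f.derivative.eval₂ j (s ^ q ^ r) ≠ 0 := by
  have hinj : Function.Injective (algebraMap S F) := FaithfulSMul.algebraMap_injective S F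
  -- The minimal polynomial is `g(X ^ q ^ r)` with `g` separable, so the power is a simple root of
  -- `g`; clearing denominators preserves this.
  obtain ⟨g, hg, r, hgr⟩ := (minpoly.irreducible hs.isIntegral).hasSeparableContraction q
  have hroot : aeval (algebraMap S F (s ^ q ^ r)) g = 0 := by
    rw [map_pow, ← expand_aeval, hgr, minpoly.aeval]
  have hsimple := hg.aeval_derivative_ne_zero hroot
  obtain ⟨b, hb, hfb⟩ := IsLocalization.integerNormalization_spec (nonZeroDivisors R) g
  set f := IsLocalization.integerNormalization (nonZeroDivisors R) g
  have hb0 : algebraMap E F (algebraMap R E b) ≠ 0 := by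
    rw [Ne, map_eq_zero, IsFractionRing.to_map_eq_zero_iff]
    exact nonZeroDivisors.ne_zero hb
  have key (h : R[X]) (x : S) :
      algebraMap S F (h.eval₂ j x) = aeval (algebraMap S F x) (h.map (algebraMap R E)) := by
    rw [hom_eval₂, ← hj, aeval_def, eval₂_map]
  have hsmul : b • g = C (algebraMap R E b) * g := by
    rw [← smul_eq_C_mul, algebraMap_smul]
  refine ⟨r, f, hinj ?_, fun h0 => ?_⟩
  · rw [key, hfb, hsmul, map_mul, hroot, mul_zero, map_zero]
  · have := key f.derivative (s ^ q ^ r)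
    rw [h0, map_zero, ← derivative_map, hfb, hsmul, derivative_C_mul, map_mul, aeval_C] at this
    exact mul_ne_zero hb0 hsimple this.symm

section

variable {n : ℕ} {k K : Type*} [Field k] [Field K] [Algebra k K]

/-- Some `q ^ r`-th power of an algebraic series has its coefficients in a finite extension. -/
theorem IsAlgebraicSeries.exists_finiteDimensional_coeffField_pow [Algebra.IsAlgebraic k K]
    (q : ℕ) [ExpChar k q] {s : MvPowerSeries (Fin n) K} (hs : IsAlgebraicSeries k s) :
    ∃ r : ℕ, FiniteDimensional k (coeffField k (s ^ q ^ r)) := by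
  let _ : Algebra (LaurentField n k) (LaurentField n K) :=
    (LaurentField.inclusion n k K).toAlgebra
  have : ExpChar (LaurentField n k) q :=
    expChar_of_injective_algebraMap (algebraMap k (LaurentField n k)).injective q
  obtain ⟨r, f, hf, hf'⟩ := IsAlgebraic.exists_simple_root_pow (E := LaurentField n k)
    (F := LaurentField n K) q (MvPowerSeries.map (algebraMap k K))
    (RingHom.ext (LaurentField.inclusion_algebraMap n k K)) hs
  refine ⟨r, ?_⟩
  set t := s ^ q ^ r
  obtain ⟨N, hN⟩ := ENat.ne_top_iff_exists.1 (mt MvPowerSeries.order_eq_top_iff.1 hf')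
  -- Finite because there are only finitely many monomials of degree at most `N`.
  let c : Set K := (fun I => MvPowerSeries.coeff I t) '' {I : Fin n →₀ ℕ | I.degree ≤ N}
  have : Finite c := ((Finsupp.finite_of_degree_le N).image _).to_subtype
  let M := IntermediateField.adjoin k c
  have : FiniteDimensional k M :=
    IntermediateField.finiteDimensional_adjoin fun x _ => Algebra.IsIntegral.isIntegral x
  have hmap : (MvPowerSeries.map (σ := Fin n) (algebraMap M K)).comp
      (MvPowerSeries.map (algebraMap k M)) = MvPowerSeries.map (algebraMap k K) := by
    rw [IsScalarTower.algebraMap_eq k M K]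
    rfl
  have hmem : ∀ I, MvPowerSeries.coeff I t ∈ Set.range (algebraMap M K) := by
    refine MvPowerSeries.coeff_mem_range_of_root
      (f.map (MvPowerSeries.map (algebraMap k M))) t ?_ ?_
    · rw [Polynomial.eval₂_map, hmap, hf]
    · intro I hI
      rw [Polynomial.derivative_map, Polynomial.eval₂_map, hmap, ← hN, Nat.cast_le] at hI
      exact ⟨⟨_, IntermediateField.subset_adjoin k c ⟨I, hI, rfl⟩⟩, rfl⟩
  have hle : coeffField k t ≤ M := by
    rw [coeffField, IntermediateField.adjoin_le_iff]
    rintro _ ⟨I, rfl⟩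
    obtain ⟨a, ha⟩ := hmem I
    change MvPowerSeries.coeff I t ∈ M
    rw [← ha]
    exact a.2
  exact Module.Finite.of_injective (IntermediateField.inclusion hle).toLinearMap
    (IntermediateField.inclusion hle).injective

/-- The series is a finite sum of series over `k` times constants algebraic over `k`, which stay
algebraic over the Laurent field. -/
theorem isAlgebraicSeries_of_coeff_mem (M : IntermediateField k K) [FiniteDimensional k M]
    {s : MvPowerSeries (Fin n) K} (hs : ∀ I, MvPowerSeries.coeff I s ∈ M) :
    IsAlgebraicSeries k s := by
  let _ : Algebra (LaurentField n k) (LaurentField n K) :=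
    (LaurentField.inclusion n k K).toAlgebra
  change IsAlgebraic (LaurentField n k) (algebraMap _ (LaurentField n K) s)
  obtain ⟨m, e, g, he, rfl⟩ := MvPowerSeries.exists_eq_sum_of_coeff_mem M s hs
  rw [map_sum]
  refine IsIntegral.isAlgebraic (IsIntegral.sum _ fun j _ => IsAlgebraic.isIntegral ?_)
  rw [map_mul, ← LaurentField.inclusion_algebraMap]
  refine IsAlgebraic.mul ?_ (isAlgebraic_algebraMap (A := LaurentField n K) _)
  obtain ⟨f, hf0, hf⟩ : IsAlgebraic k (e j) :=
    (Algebra.IsAlgebraic.isAlgebraic (R := k) (⟨e j, he j⟩ : M)).algebraMap (A := K)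
  let ι : k →+* LaurentField n k :=
    (algebraMap (MvPowerSeries (Fin n) k) (LaurentField n k)).comp MvPowerSeries.C
  let κ : K →+* LaurentField n K :=
    (algebraMap (MvPowerSeries (Fin n) K) (LaurentField n K)).comp MvPowerSeries.C
  have hι : (algebraMap (LaurentField n k) (LaurentField n K)).comp ι =
      κ.comp (algebraMap k K) := by
    ext a
    refine (LaurentField.inclusion_algebraMap n k K (MvPowerSeries.C a)).trans ?_
    rw [MvPowerSeries.map_C]
    rfl
  refine ⟨f.map ι, (Polynomial.map_ne_zero_iff ι.injective).2 hf0, ?_⟩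
  have hroot : f.eval₂ (κ.comp (algebraMap k K)) (κ (e j)) = 0 := by
    rw [← Polynomial.hom_eval₂, ← Polynomial.aeval_def, hf, map_zero]
  rw [Polynomial.aeval_def, Polynomial.eval₂_map, hι]
  exact hroot

theorem IsAlgebraicSeries.of_pow {s : MvPowerSeries (Fin n) K} {m : ℕ} (hm : 0 < m)
    (hs : IsAlgebraicSeries k (s ^ m)) : IsAlgebraicSeries k s := by
  let _ : Algebra (LaurentField n k) (LaurentField n K) :=
    (LaurentField.inclusion n k K).toAlgebra
  have : IsAlgebraic (LaurentField n k) (algebraMap _ (LaurentField n K) (s ^ m)) := hs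
  rw [map_pow] at this
  exact this.of_pow hm

theorem coeffField_pow_expChar_eq_adjoin (q : ℕ) [ExpChar K q] (r : ℕ)
    (s : MvPowerSeries (Fin n) K) :
    coeffField k (s ^ q ^ r) =
      IntermediateField.adjoin k {y | ∃ x ∈ coeffField k s, y = x ^ q ^ r} := by
  apply le_antisymm
  · rw [coeffField, IntermediateField.adjoin_le_iff]
    rintro _ ⟨I, rfl⟩
    rcases MvPowerSeries.coeff_pow_expChar_mem q r s I with h | ⟨J, h⟩
    · change MvPowerSeries.coeff I (s ^ q ^ r) ∈ _
      rw [h]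
      exact zero_mem _
    · exact IntermediateField.subset_adjoin _ _
        ⟨_, IntermediateField.subset_adjoin _ _ ⟨J, rfl⟩, h⟩
  · rw [IntermediateField.adjoin_le_iff]
    rintro _ ⟨x, hx, rfl⟩
    change x ^ q ^ r ∈ coeffField k (s ^ q ^ r)
    induction hx using IntermediateField.adjoin_induction with
    | mem x hx =>
      obtain ⟨I, rfl⟩ := hx
      exact IntermediateField.subset_adjoin _ _
        ⟨q ^ r • I, MvPowerSeries.coeff_pow_expChar_smul q r s I⟩
    | algebraMap a => exact pow_mem (IntermediateField.algebraMap_mem _ a) _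
    | add x y _ _ hx hy => rw [add_pow_expChar_pow]; exact add_mem hx hy
    | inv x _ hx => rw [inv_pow]; exact inv_mem hx
    | mul x y _ _ hx hy => rw [mul_pow]; exact mul_mem hx hy

theorem isAlgebraicSeries_iff_exists_finiteDimensional_coeffField_pow [Algebra.IsAlgebraic k K]
    (q : ℕ) [ExpChar k q] (s : MvPowerSeries (Fin n) K) :
    IsAlgebraicSeries k s ↔ ∃ r : ℕ, FiniteDimensional k (coeffField k (s ^ q ^ r)) := by
  refine ⟨fun h => h.exists_finiteDimensional_coeffField_pow q, fun ⟨r, _⟩ => ?_⟩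
  refine .of_pow (pow_pos (expChar_pos k q) r) (isAlgebraicSeries_of_coeff_mem
    (coeffField k (s ^ q ^ r)) fun I => IntermediateField.subset_adjoin _ _ ⟨I, rfl⟩)

end

theorem theorem1p1 {k kbar : Type*} [Field k] [Field kbar] [Algebra k kbar]
    [IsAlgClosure k kbar] (p : ℕ) [CharP k p] (n : ℕ) (σ : MvPowerSeries (Fin n) kbar) :
    IsAlgebraicSeries k σ ↔
      ∃ r : ℕ, FiniteDimensional k (powerCompositum p (coeffField k σ) r) := by
  have : Algebra.IsAlgebraic k kbar := IsAlgClosure.isAlgebraic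
  rcases CharP.char_is_prime_or_zero k p with hp | rfl
  · have : Fact p.Prime := ⟨hp⟩
    have : ExpChar k p := .prime hp
    have : ExpChar kbar p := expChar_of_injective_algebraMap (algebraMap k kbar).injective p
    have heq (r : ℕ) : powerCompositum p (coeffField k σ) r = coeffField k (σ ^ p ^ r) := by
      rw [coeffField_pow_expChar_eq_adjoin, powerCompositum, powerField, if_neg hp.ne_zero]
    rw [isAlgebraicSeries_iff_exists_finiteDimensional_coeffField_pow p]
    exact exists_congr fun r => by rw [heq]
  -- The exponential characteristic is `1`, so every power `σ ^ 1 ^ r` is `σ` itself.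
  · have : CharZero k := CharP.charP_to_charZero k
    have heq (r : ℕ) : powerCompositum 0 (coeffField k σ) r = coeffField k (σ ^ 1 ^ r) := by
      rw [powerCompositum, powerField, if_pos rfl, one_pow, pow_one,
        IntermediateField.adjoin_self]
    rw [isAlgebraicSeries_iff_exists_finiteDimensional_coeffField_pow 1]
    exact exists_congr fun r => by rw [heq]
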